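/- Let $\mathcal A=\{a_i : i\ge 1\}$ be a countably infinite alphabet, and let $\mathbf P=\{p_i : i\ge 1\}$ be a probability distribution on $\mathcal A$ (some, even infinitely many, of the $p_i$ may be $0$). Let $g:[0,1]\to\mathbb R$ be differentiable on $[0,1]$ (one-sidedly at the endpoints), and suppose that $g'$ is $\beta$-Hölder continuous for some $\beta\in(0,1]$, i.e. there is $M>0$ with $|g'(x)-g'(y)|\le M|x-y|^\beta$ for all $x,y\in[0,1]$. Assume $\sum_{i}|g(p_i)|<\infty$, and put $\theta=\sum_{i} g(p_i)$, $$\sigma^2=\sum_{i=1}^\infty p_i\,g'(p_i)^2-\Big(\sum_{i=1}^\infty p_i\,g'(p_i)\Big)^2,\qquad \gamma=\begin{cases}\beta/2 & \text{if } \beta\in(0,1/2],\\ \beta-1/2 & \text{if } \beta\in(1/2,1],\end{cases}$$ and assume $\sigma^2>0$, with $\sigma=\sqrt{\sigma^2}$. Suppose that either 1. $\beta\in(1/2,1]$, or 2. $\beta\in(0,1/2]$ and $\sum_{i=1}^\infty p_i^{(\beta+1)/2}<\infty$. Then there is a constant $C$, depending only on $g$, $\beta$ and $\mathbf P$, such that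 for every sequence $X_1,X_2,\dots$ of independent $\mathcal A$-valued random variables with distribution $\mathbf P$ and every $n\ge 1$, $$\sup_{x\in\mathbb R}\left|\mathbb P\!\left(\frac{\sqrt n}{\sigma}\,(\hat\theta_n-\theta)\le x\right)-\Phi(x)\right|\le \frac{C}{n^{\gamma/2}},$$ where $\hat p_i=\frac1n\sum_{k=1}^n I_{\{X_k=a_i\}}$ is the sample proportion of $a_i$, $\hat\theta_n=\sum_{i=1}^\infty g(\hat p_i)$ is the plug-in estimator of $\theta$, and $\Phi$ is the standard normal distribution function. -/

import Mathlib

open MeasureTheory ProbabilityTheory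
open scoped NNReal

noncomputable section

namespace DiversityIndex

/-- The derivative of a function on the interval `[0, 1]` (one-sided at the endpoints). -/
def deriv01 (g : ℝ → ℝ) (x : ℝ) : ℝ :=
  derivWithin g (Set.Icc 0 1) x

/-- `p` is a probability distribution on the alphabet `A`; some of the `p a` may vanish. -/
structure IsDistribution {A : Type*} (p : A → ℝ) : Prop where
  nonneg : ∀ a, 0 ≤ p a
  hasSum : HasSum p 1

/-- The index `∑ g (p a)`, the sum running over all letters of the alphabet. -/
def index {A : Type*} (g : ℝ → ℝ) (p : A → ℝ) : ℝ :=
  ∑' a, g (p a)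

/-- The asymptotic variance `∑ p a * g'(p a)^2 - (∑ p a * g'(p a))^2`. -/
def asympVar {A : Type*} (g : ℝ → ℝ) (p : A → ℝ) : ℝ :=
  (∑' a, p a * (deriv01 g (p a)) ^ 2) - (∑' a, p a * deriv01 g (p a)) ^ 2

/-- The sample proportion of the letter `a` among the first `n` terms of the sequence `x`. -/
def sampleProp {A : Type*} (n : ℕ) (x : ℕ → A) (a : A) : ℝ :=
  (1 / (n : ℝ)) * ∑ k ∈ Finset.range n, ({a} : Set A).indicator (fun _ => (1 : ℝ)) (x k)

/-- The plug-in estimator of the index based on the first `n` observations. -/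
def plugIn {A : Type*} (g : ℝ → ℝ) (n : ℕ) (x : ℕ → A) : ℝ :=
  index g (sampleProp n x)

/-- The exponent `γ`: it is `β / 2` for `β ≤ 1 / 2` and `β - 1 / 2` for `β > 1 / 2`. -/
def rateExponent (β : ℝ) : ℝ :=
  if β ≤ 1 / 2 then β / 2 else β - 1 / 2

/-- The observations `X 0, X 1, …` are independent, each with distribution `p`. -/
structure IsIIDSample {Ω A : Type*} [MeasurableSpace Ω] [MeasurableSpace A]
    (μ : Measure Ω) (X : ℕ → Ω → A) (p : A → ℝ) : Prop where
  measurable : ∀ k, Measurable (X k)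
  indep : iIndepFun X μ
  law : ∀ k a, μ.real {ω | X k ω = a} = p a

end DiversityIndex

end

namespace DiversityIndex


/-! The estimator is linearised. Since g' is Hölder, it is bounded on [0, 1], and a first-order
Taylor expansion at each p a writes θ̂ₙ - θ as the average of the centred bounded i.i.d. variables
g'(p (X k)), of variance σ², plus a remainder R with |R| ≤ M ∑ |p̂ a - p a|^(1+β). Either
summability regime gives E|R| = O(n^(-(1/2+γ))) (`exists_summable_moment_bound`,
`exists_integral_abs_remainder_le`).

For the linear part, Stein's method with a leave-one-out argument (`exists_normal_approx_lipschitz`)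
gives an error O((1 + L)/√n) for test functions with values in [0, 1] and Lipschitz constant L. For
such functions the remainder costs a further L √n E|R| = O(L n^(-γ)).

Indicators of half-lines lie between ramps of width δ and L = 1/δ (`abs_measureReal_sub_cdf_le`),
which costs another δ. As γ ≤ 1/2, the total is O(n^(-γ)/δ + δ), and δ = n^(-γ/2) balances it. This
is the origin of the halved exponent; the sharp Berry–Esseen theorem is not needed. -/

/-! ### Stein's equation for the standard normal law -/

theorem integrable_exp_neg_half_sq : Integrable fun t : ℝ => Real.exp (-t ^ 2 / 2) := by
  have := integrable_exp_neg_mul_sq (b := (1 / 2 : ℝ)) (by norm_num)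
  refine this.congr (.of_forall fun t => ?_)
  simp only []; congr 1; ring

/-- The Mills ratio bound. -/
theorem mul_integral_Ioi_exp_le {x : ℝ} (hx : 0 ≤ x) :
    x * ∫ t in Set.Ioi x, Real.exp (-t ^ 2 / 2) ≤ Real.exp (-x ^ 2 / 2) := by
  have hlim : Filter.Tendsto (fun t : ℝ => -Real.exp (-t ^ 2 / 2)) Filter.atTop (nhds (-0)) := by
    refine (Real.tendsto_exp_atBot.comp ?_).neg
    have h1 : Filter.Tendsto (fun t : ℝ => t ^ 2 / 2) Filter.atTop Filter.atTop :=
      (Filter.tendsto_pow_atTop two_ne_zero).atTop_div_const (by norm_num)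
    refine (Filter.tendsto_neg_atTop_atBot.comp h1).congr fun t => ?_
    simp only [Function.comp]; ring
  have hd : ∀ t ∈ Set.Ici x,
      HasDerivAt (fun t : ℝ => -Real.exp (-t ^ 2 / 2)) (t * Real.exp (-t ^ 2 / 2)) t := by
    intro t _
    have h1 : HasDerivAt (fun t : ℝ => -t ^ 2 / 2) (-t) t :=
      ((hasDerivAt_pow 2 t).neg.div_const 2).congr_deriv (by norm_num; ring)
    exact h1.exp.neg.congr_deriv (by ring)
  have hnn : ∀ t ∈ Set.Ioi x, 0 ≤ t * Real.exp (-t ^ 2 / 2) := fun t ht =>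
    mul_nonneg (hx.trans (le_of_lt ht)) (Real.exp_pos _).le
  have hint := integrableOn_Ioi_deriv_of_nonneg' hd hnn hlim
  have hval := integral_Ioi_of_hasDerivAt_of_tendsto' hd hint hlim
  rw [← integral_const_mul]
  calc ∫ t in Set.Ioi x, x * Real.exp (-t ^ 2 / 2)
      ≤ ∫ t in Set.Ioi x, t * Real.exp (-t ^ 2 / 2) := by
        refine setIntegral_mono_on (integrable_exp_neg_half_sq.const_mul x).integrableOn hint
          measurableSet_Ioi fun t ht => ?_
        exact mul_le_mul_of_nonneg_right (le_of_lt ht) (Real.exp_pos _).le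
    _ = Real.exp (-x ^ 2 / 2) := by rw [hval]; ring

theorem integral_gaussianReal_standard (h : ℝ → ℝ) :
    ∫ x, h x ∂(gaussianReal 0 1) = (√(2 * Real.pi))⁻¹ * ∫ x, h x * Real.exp (-x ^ 2 / 2) := by
  rw [integral_gaussianReal_eq_integral_smul one_ne_zero, ← integral_const_mul]
  congr 1; ext x
  simp [gaussianPDFReal]
  ring

/-- Bounds of the solution of Stein's equation, uniform over test functions with values in
`[0, 1]`. -/
theorem exists_stein_solution :
    ∃ K : ℝ, 0 ≤ K ∧ ∀ h : ℝ → ℝ, Continuous h → (∀ x, 0 ≤ h x) → (∀ x, h x ≤ 1) →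
      ∃ f : ℝ → ℝ,
        (∀ x, HasDerivAt f (x * f x + (h x - ∫ z, h z ∂(gaussianReal 0 1))) x) ∧
        (∀ x, |f x| ≤ K) ∧ ∀ x, |x * f x| ≤ 1 := by
  set E : ℝ → ℝ := fun t => Real.exp (-t ^ 2 / 2) with hE
  have hEi : Integrable E := integrable_exp_neg_half_sq
  have hEpos : ∀ t, 0 < E t := fun t => Real.exp_pos _
  have hEe : ∀ x, Real.exp (x ^ 2 / 2) * E x = 1 := fun x => by
    rw [hE, ← Real.exp_add]; simp; ring
  have hI0 : 0 ≤ ∫ t, E t := integral_nonneg fun t => (hEpos t).le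
  -- The first summand bounds f on [-1, 1]; the `1` bounds it elsewhere, where |f x| ≤ |x * f x| ≤
  -- 1.
  refine ⟨Real.exp (1 / 2) * (∫ t, E t) + 1, by positivity, fun h hc h0 h1 => ?_⟩
  set c := ∫ z, h z ∂(gaussianReal 0 1) with hcdef
  have hhi : Integrable h (gaussianReal 0 1) :=
    Integrable.of_bound hc.aestronglyMeasurable 1
      (.of_forall fun x => by rw [Real.norm_eq_abs, abs_le]; constructor <;> linarith [h0 x, h1 x])
  have hc0 : 0 ≤ c := integral_nonneg h0
  have hc1 : c ≤ 1 := by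
    have := integral_mono hhi (integrable_const (1 : ℝ)) h1
    simpa using this
  set q : ℝ → ℝ := fun t => (h t - c) * E t with hq
  have hqc : Continuous q := by
    have : Continuous E := by fun_prop
    fun_prop
  have hqE : ∀ t, ‖q t‖ ≤ E t := fun t => by
    rw [hq, norm_mul, Real.norm_eq_abs, Real.norm_eq_abs, abs_of_pos (hEpos t)]
    refine mul_le_of_le_one_left (hEpos t).le ?_
    rw [abs_le]; constructor <;> linarith [h0 t, h1 t]
  have hqi : Integrable q := hEi.mono' hqc.aestronglyMeasurable (.of_forall hqE)
  have hhEi : Integrable fun t => h t * E t := by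
    have : Integrable fun t => q t + c * E t := hqi.add (hEi.const_mul c)
    refine this.congr (.of_forall fun t => ?_)
    simp only [hq]; ring
  -- Centring at the Gaussian mean makes the total integral vanish, so `Q` is both a left tail and
  -- minus a right tail. Each half-line can then use the tail on its own side, where the Mills bound
  -- applies.
  have hq0 : ∫ t, q t = 0 := by
    have e1 : ∫ t, q t = (∫ t, h t * E t) - c * ∫ t, E t := by
      rw [← integral_const_mul, ← integral_sub hhEi (hEi.const_mul c)]
      congr 1; ext t; simp only [hq]; ring
    have e2 := integral_gaussianReal_standard h
    have e3 := integral_gaussianReal_standard fun _ => 1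
    simp only [integral_const, probReal_univ, one_mul, smul_eq_mul] at e3
    have hs : (√(2 * Real.pi))⁻¹ ≠ 0 := by positivity
    rw [e1, sub_eq_zero]
    apply mul_left_cancel₀ hs
    rw [← e2, mul_left_comm, ← e3, mul_one]
  set Q : ℝ → ℝ := fun x => ∫ t in Set.Iic x, q t with hQ
  have hQI : ∀ x, Q x = -∫ t in Set.Ioi x, q t := fun x => by
    have := integral_add_compl (μ := volume) (s := Set.Iic x) measurableSet_Iic hqi
    rw [Set.compl_Iic, hq0] at this
    linarith
  have hQd : ∀ x, HasDerivAt Q (q x) x := fun x => by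
    have e : Q = fun y => (∫ t in Set.Iic 0, q t) + ∫ t in (0 : ℝ)..y, q t := by
      ext y
      rw [← intervalIntegral.integral_Iic_sub_Iic hqi.integrableOn hqi.integrableOn]
      simp only [hQ]; ring
    rw [e]
    exact (intervalIntegral.integral_hasDerivAt_right (hqc.intervalIntegrable _ _)
      (hqc.stronglyMeasurableAtFilter _ _) hqc.continuousAt).const_add _
  have hQall : ∀ x, |Q x| ≤ ∫ t, E t := fun x => by
    calc |Q x| ≤ ∫ t in Set.Iic x, E t :=
          norm_integral_le_of_norm_le hEi.integrableOn (.of_forall hqE)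
      _ ≤ ∫ t, E t := setIntegral_le_integral hEi (.of_forall fun t => (hEpos t).le)
  have hQx : ∀ x, |x * Q x| ≤ E x := fun x => by
    rw [abs_mul]
    rcases le_total 0 x with hx | hx
    · rw [abs_of_nonneg hx, hQI, abs_neg]
      refine le_trans (mul_le_mul_of_nonneg_left ?_ hx) (mul_integral_Ioi_exp_le hx)
      exact norm_integral_le_of_norm_le hEi.integrableOn (.of_forall hqE)
    · rw [abs_of_nonpos hx]
      have hx' : 0 ≤ -x := by linarith
      have e : ∫ t in Set.Iic x, E t = ∫ t in Set.Ioi (-x), E t := by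
        rw [← integral_comp_neg_Iic]
        simp [hE]
      have hm := mul_integral_Ioi_exp_le hx'
      rw [neg_sq] at hm
      refine le_trans (mul_le_mul_of_nonneg_left ?_ hx') hm
      rw [← e]
      exact norm_integral_le_of_norm_le hEi.integrableOn (.of_forall hqE)
  have hxf : ∀ x, |x * (Real.exp (x ^ 2 / 2) * Q x)| ≤ 1 := fun x => by
    rw [mul_left_comm, abs_mul, Real.abs_exp, ← hEe x]
    exact mul_le_mul_of_nonneg_left (hQx x) (Real.exp_pos _).le
  -- Solution by the integrating factor exp(-x²/2).
  refine ⟨fun x => Real.exp (x ^ 2 / 2) * Q x, fun x => ?_, fun x => ?_, hxf⟩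
  · have h1 : HasDerivAt (fun t : ℝ => t ^ 2 / 2) x x :=
      ((hasDerivAt_pow 2 x).div_const 2).congr_deriv (by norm_num)
    have h2 : Real.exp (x ^ 2 / 2) * q x = h x - c := by
      simp only [hq]; rw [mul_left_comm, hEe, mul_one]
    refine (h1.exp.mul (hQd x)).congr_deriv ?_
    rw [h2]; ring
  · rcases le_total |x| 1 with hx | hx
    · rw [abs_mul, Real.abs_exp]
      have : Real.exp (x ^ 2 / 2) ≤ Real.exp (1 / 2) := by
        apply Real.exp_le_exp.2
        have := (sq_le_one_iff_abs_le_one x).2 hx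
        linarith
      have := mul_le_mul this (hQall x) (abs_nonneg _) (Real.exp_pos _).le
      linarith
    · have h2 := hxf x
      rw [abs_mul] at h2
      have h3 : 0 ≤ Real.exp (1 / 2) * ∫ t, E t := by positivity
      nlinarith [abs_nonneg (Real.exp (x ^ 2 / 2) * Q x)]

/-! ### Local regularity of the Stein solution -/

section SteinFunction

variable {f h : ℝ → ℝ} {c K L : ℝ}

/-- With `h` merely Lipschitz, f' is controlled through the equation itself, by splitting the
increment of x * f x as w (f(w+u) - f w) + u f(w+u). The linear growth in |w| is harmless: later
only the first absolute moment of w enters. -/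
theorem abs_stein_deriv_sub_le
    (hf : ∀ x, HasDerivAt f (x * f x + (h x - c)) x) (hK : ∀ x, |f x| ≤ K)
    (hD : ∀ x, |x * f x + (h x - c)| ≤ 2) (hL : ∀ x y, |h x - h y| ≤ L * |x - y|) (w u : ℝ) :
    |((w + u) * f (w + u) + (h (w + u) - c)) - (w * f w + (h w - c))|
      ≤ (2 * |w| + (K + L)) * |u| := by
  have h1 : |f (w + u) - f w| ≤ 2 * |u| := by
    have := convex_univ.norm_image_sub_le_of_norm_hasDerivWithin_le (f := f) (C := 2)
      (fun x _ => (hf x).hasDerivWithinAt) (fun x _ => hD x) (Set.mem_univ w)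
      (Set.mem_univ (w + u))
    simpa using this
  have h2 : |h (w + u) - h w| ≤ L * |u| := by simpa using hL (w + u) w
  have e : ((w + u) * f (w + u) + (h (w + u) - c)) - (w * f w + (h w - c))
      = w * (f (w + u) - f w) + u * f (w + u) + (h (w + u) - h w) := by ring
  rw [e]
  have h3 : |w * (f (w + u) - f w)| ≤ |w| * (2 * |u|) := by
    rw [abs_mul]; exact mul_le_mul_of_nonneg_left h1 (abs_nonneg _)
  have h4 : |u * f (w + u)| ≤ |u| * K := by
    rw [abs_mul]; exact mul_le_mul_of_nonneg_left (hK _) (abs_nonneg _)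
  have h5 := abs_add_three (w * (f (w + u) - f w)) (u * f (w + u)) (h (w + u) - h w)
  linarith

/-- Mean value inequality for t ↦ f (w + t) - t f' w on [-|u|, |u|], whose derivative is small by
the previous lemma. -/
theorem abs_stein_taylor_le
    (hf : ∀ x, HasDerivAt f (x * f x + (h x - c)) x) (hK : ∀ x, |f x| ≤ K)
    (hD : ∀ x, |x * f x + (h x - c)| ≤ 2) (hL : ∀ x y, |h x - h y| ≤ L * |x - y|) (hL0 : 0 ≤ L)
    (w u : ℝ) :
    |f (w + u) - f w - u * (w * f w + (h w - c))| ≤ (2 * |w| + (K + L)) * |u| * |u| := by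
  have hK0 : 0 ≤ K := (abs_nonneg _).trans (hK 0)
  have := (convex_Icc (-|u|) |u|).norm_image_sub_le_of_norm_hasDerivWithin_le
    (f := fun t => f (w + t) - t * (w * f w + (h w - c)))
    (f' := fun t => ((w + t) * f (w + t) + (h (w + t) - c)) - (w * f w + (h w - c)))
    (C := (2 * |w| + (K + L)) * |u|) (x := 0) (y := u)
    (fun t _ => ?_) (fun t ht => ?_) (by simp) (abs_le.1 le_rfl)
  · simpa [sub_right_comm] using this
  · refine (((hf (w + t)).comp_const_add w t).sub
      ((hasDerivAt_id t).mul_const _)).hasDerivWithinAt.congr_deriv ?_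
    simp
  · refine (abs_stein_deriv_sub_le hf hK hD hL w t).trans ?_
    exact mul_le_mul_of_nonneg_left (abs_le.2 ht) (by positivity)

end SteinFunction

/-! ### Normal approximation of sums of bounded independent variables -/

section BoundedSummands

variable {Ω : Type*} [MeasurableSpace Ω] {μ : Measure Ω} [IsProbabilityMeasure μ]
  {ξ : ℕ → Ω → ℝ} {b v : ℝ}

theorem integrable_of_abs_le {Y : Ω → ℝ} {C : ℝ} (hm : Measurable Y) (hC : ∀ ω, |Y ω| ≤ C) :
    Integrable Y μ :=
  Integrable.of_bound hm.aestronglyMeasurable C (.of_forall hC)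

theorem memLp_two_of_abs_le {Y : Ω → ℝ} {C : ℝ} (hm : Measurable Y) (hC : ∀ ω, |Y ω| ≤ C) :
    MemLp Y 2 μ :=
  MemLp.of_bound hm.aestronglyMeasurable C (.of_forall hC)

theorem integral_sum_sq (hm : ∀ k, Measurable (ξ k)) (hind : iIndepFun ξ μ)
    (hb : ∀ k ω, |ξ k ω| ≤ b) (h0 : ∀ k, ∫ ω, ξ k ω ∂μ = 0)
    (hv : ∀ k, ∫ ω, ξ k ω ^ 2 ∂μ = v) (s : Finset ℕ) :
    ∫ ω, (∑ k ∈ s, ξ k ω) ^ 2 ∂μ = s.card * v := by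
  have h := IndepFun.variance_sum (X := ξ) (s := s) (μ := μ)
    (fun k _ => memLp_two_of_abs_le (hm k) (hb k))
    (fun i _ j _ hij => hind.indepFun hij)
  rw [variance_of_integral_eq_zero (by fun_prop)] at h
  · have e : ∀ k, Var[ξ k; μ] = v := fun k => by
      rw [variance_of_integral_eq_zero (hm k).aemeasurable (h0 k), ← hv k]
    simpa [e] using h
  · simp only [Finset.sum_apply]
    rw [integral_finsetSum _ fun k _ => integrable_of_abs_le (hm k) (hb k)]
    simp [h0]

theorem integral_abs_sum_le_one (hm : ∀ k, Measurable (ξ k)) (hind : iIndepFun ξ μ)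
    (hb : ∀ k ω, |ξ k ω| ≤ b) (h0 : ∀ k, ∫ ω, ξ k ω ∂μ = 0)
    (hv : ∀ k, ∫ ω, ξ k ω ^ 2 ∂μ = v) (s : Finset ℕ) (hs : s.card * v ≤ 1) :
    ∫ ω, |∑ k ∈ s, ξ k ω| ∂μ ≤ 1 := by
  have hbd : ∀ ω, |∑ k ∈ s, ξ k ω| ≤ ∑ k ∈ s, b := fun ω =>
    (Finset.abs_sum_le_sum_abs _ _).trans (Finset.sum_le_sum fun k _ => hb k ω)
  have hms : Measurable fun ω => ∑ k ∈ s, ξ k ω := by fun_prop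
  have hi2 : Integrable (fun ω => (∑ k ∈ s, ξ k ω) ^ 2) μ :=
    (memLp_two_of_abs_le hms hbd).integrable_sq
  calc ∫ ω, |∑ k ∈ s, ξ k ω| ∂μ
      ≤ ∫ ω, (1 / 2 + (1 / 2) * (∑ k ∈ s, ξ k ω) ^ 2) ∂μ := by
        refine integral_mono (integrable_of_abs_le hms hbd).abs
          ((integrable_const _).add (hi2.const_mul _)) fun ω => ?_
        simp only []
        rw [← sq_abs (∑ k ∈ s, ξ k ω)]
        nlinarith [sq_nonneg (|∑ k ∈ s, ξ k ω| - 1)]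
    _ = 1 / 2 + 1 / 2 * (s.card * v) := by
        rw [integral_add (integrable_const _) (hi2.const_mul _), integral_const_mul,
          integral_sum_sq hm hind hb h0 hv]
        simp
    _ ≤ 1 := by linarith

/-- The leave-one-out step: `X` is one summand and `V` the sum of the others. Expanding f at `V`,
independence gives E[X f(V)] = 0 and E[X² f'(V)] = v E[f'(V)]. The Taylor error yields the term `b ^
3`, and replacing f'(V) by f'(V + X) yields `v * b`. -/
theorem abs_integral_mul_stein_sub_le {f h : ℝ → ℝ} {c K L : ℝ} {X V : Ω → ℝ}
    (hf : ∀ x, HasDerivAt f (x * f x + (h x - c)) x) (hK : ∀ x, |f x| ≤ K)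
    (hD : ∀ x, |x * f x + (h x - c)| ≤ 2) (hhc : Continuous h)
    (hL : ∀ x y, |h x - h y| ≤ L * |x - y|) (hL0 : 0 ≤ L)
    (hX : Measurable X) (hV : Measurable V) (hXV : IndepFun X V μ) (hb : ∀ ω, |X ω| ≤ b)
    (hVi : Integrable V μ) (h0 : ∫ ω, X ω ∂μ = 0) (hv : ∫ ω, X ω ^ 2 ∂μ = v) :
    |∫ ω, X ω * f (V ω + X ω) ∂μ
        - v * ∫ ω, ((V ω + X ω) * f (V ω + X ω) + (h (V ω + X ω) - c)) ∂μ|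
      ≤ (b ^ 3 + v * b) * (2 * (∫ ω, |V ω| ∂μ) + (K + L)) := by
  set D : ℝ → ℝ := fun x => x * f x + (h x - c) with hDdef
  have hfc : Continuous f := continuous_iff_continuousAt.2 fun x => (hf x).continuousAt
  have hDc : Continuous D := by fun_prop
  have hfm := hfc.measurable
  have hDm := hDc.measurable
  have hK0 : 0 ≤ K := (abs_nonneg _).trans (hK 0)
  have hv0 : 0 ≤ v := hv ▸ integral_nonneg fun ω => sq_nonneg _
  have hXi : Integrable X μ := integrable_of_abs_le hX hb
  have iff' : ∀ Y : Ω → ℝ, Measurable Y → Integrable (fun ω => X ω * f (Y ω)) μ := fun Y hY =>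
    hXi.mul_bdd (c := K) (hfm.comp hY).aestronglyMeasurable (.of_forall fun ω => hK _)
  have iD : ∀ Y : Ω → ℝ, Measurable Y → Integrable (fun ω => D (Y ω)) μ := fun Y hY =>
    integrable_of_abs_le (hDm.comp hY) fun ω => hD _
  have hX2 : Integrable (fun ω => X ω ^ 2) μ := (memLp_two_of_abs_le hX hb).integrable_sq
  have iXD : Integrable (fun ω => X ω ^ 2 * D (V ω)) μ :=
    hX2.mul_bdd (c := 2) (hDm.comp hV).aestronglyMeasurable (.of_forall fun ω => hD _)
  have hW : Measurable fun ω => V ω + X ω := hV.add hX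
  have e1 : ∫ ω, X ω * f (V ω) ∂μ = 0 := by
    have := (hXV.comp measurable_id hfm).integral_fun_mul_eq_mul_integral
      hX.aestronglyMeasurable (hfm.comp hV).aestronglyMeasurable
    simpa [h0] using this
  have e2 : ∫ ω, X ω ^ 2 * D (V ω) ∂μ = v * ∫ ω, D (V ω) ∂μ := by
    have := (hXV.comp (measurable_id.pow_const 2) hDm).integral_fun_mul_eq_mul_integral
      (hX.pow_const 2).aestronglyMeasurable (hDm.comp hV).aestronglyMeasurable
    simpa [hv] using this
  have hA : ∀ C : ℝ, Integrable (fun ω => C * (2 * |V ω| + (K + L))) μ := fun C =>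
    (((hVi.abs.const_mul 2).add (integrable_const _)).const_mul C)
  have eA : ∀ C : ℝ, ∫ ω, C * (2 * |V ω| + (K + L)) ∂μ
      = C * (2 * (∫ ω, |V ω| ∂μ) + (K + L)) := fun C => by
    rw [integral_const_mul, integral_add (hVi.abs.const_mul 2) (integrable_const _),
      integral_const_mul]
    simp
  have b1 : |∫ ω, (X ω * f (V ω + X ω) - X ω * f (V ω) - X ω ^ 2 * D (V ω)) ∂μ|
      ≤ b ^ 3 * (2 * (∫ ω, |V ω| ∂μ) + (K + L)) := by
    rw [← eA, ← Real.norm_eq_abs]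
    refine norm_integral_le_of_norm_le (hA (b ^ 3)) (.of_forall fun ω => ?_)
    have ht := abs_stein_taylor_le hf hK hD hL hL0 (V ω) (X ω)
    have e : X ω * f (V ω + X ω) - X ω * f (V ω) - X ω ^ 2 * D (V ω)
        = X ω * (f (V ω + X ω) - f (V ω) - X ω * D (V ω)) := by ring
    rw [e, Real.norm_eq_abs, abs_mul]
    have hp : |X ω| ^ 3 ≤ b ^ 3 := pow_le_pow_left₀ (abs_nonneg _) (hb ω) 3
    calc |X ω| * |f (V ω + X ω) - f (V ω) - X ω * D (V ω)|
        ≤ |X ω| * ((2 * |V ω| + (K + L)) * |X ω| * |X ω|) :=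
          mul_le_mul_of_nonneg_left ht (abs_nonneg _)
      _ = |X ω| ^ 3 * (2 * |V ω| + (K + L)) := by ring
      _ ≤ b ^ 3 * (2 * |V ω| + (K + L)) := mul_le_mul_of_nonneg_right hp (by positivity)
  have b2 : |∫ ω, (D (V ω + X ω) - D (V ω)) ∂μ|
      ≤ b * (2 * (∫ ω, |V ω| ∂μ) + (K + L)) := by
    rw [← eA, ← Real.norm_eq_abs]
    refine norm_integral_le_of_norm_le (hA b) (.of_forall fun ω => ?_)
    have ht := abs_stein_deriv_sub_le hf hK hD hL (V ω) (X ω)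
    refine ht.trans ?_
    rw [mul_comm b]
    exact mul_le_mul_of_nonneg_left (hb ω) (by positivity)
  have i1 : Integrable (fun ω => X ω * f (V ω + X ω) - X ω * f (V ω)) μ :=
    (iff' _ hW).sub (iff' _ hV)
  rw [integral_sub i1 iXD, integral_sub (iff' _ hW) (iff' _ hV), e1,
    e2] at b1
  rw [integral_sub (iD _ hW) (iD _ hV)] at b2
  have b3 := mul_le_mul_of_nonneg_left b2 hv0
  rw [← abs_of_nonneg hv0, ← abs_mul, abs_of_nonneg hv0] at b3
  have := abs_sub (((∫ ω, X ω * f (V ω + X ω) ∂μ) - 0) - v * ∫ ω, D (V ω) ∂μ)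
    (v * ((∫ ω, D (V ω + X ω) ∂μ) - ∫ ω, D (V ω) ∂μ))
  have e3 : ((∫ ω, X ω * f (V ω + X ω) ∂μ) - 0) - v * (∫ ω, D (V ω) ∂μ)
    - (v * ((∫ ω, D (V ω + X ω) ∂μ) - ∫ ω, D (V ω) ∂μ))
    = (∫ ω, X ω * f (V ω + X ω) ∂μ) - v * ∫ ω, D (V ω + X ω) ∂μ := by ring
  rw [e3] at this
  simp only [hDdef] at this b1 b3
  refine this.trans ((add_le_add b1 b3).trans_eq (by ring))

/-- Normal approximation of a standardised sum of bounded independent summands, tested against a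
Lipschitz function with values in `[0, 1]`. -/
theorem exists_normal_approx_lipschitz :
    ∃ K : ℝ, 0 ≤ K ∧ ∀ {Ω : Type*} [MeasurableSpace Ω] (μ : Measure Ω) [IsProbabilityMeasure μ]
      (ξ : ℕ → Ω → ℝ) (b : ℝ) (n : ℕ) (h : ℝ → ℝ) (L : ℝ), (∀ k, Measurable (ξ k)) →
      iIndepFun ξ μ → (∀ k ω, |ξ k ω| ≤ b) → (∀ k, ∫ ω, ξ k ω ∂μ = 0) → 1 ≤ n →
      (∀ k, ∫ ω, ξ k ω ^ 2 ∂μ = 1 / n) → Continuous h → (∀ x, 0 ≤ h x) → (∀ x, h x ≤ 1) →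
      0 ≤ L → (∀ x y, |h x - h y| ≤ L * |x - y|) →
      |∫ ω, h (∑ k ∈ Finset.range n, ξ k ω) ∂μ - ∫ z, h z ∂(gaussianReal 0 1)|
        ≤ (b ^ 2 * n + 1) * b * (K + L) := by
  obtain ⟨K, hK0, hK⟩ := exists_stein_solution
  -- The `2` is the coefficient of E|V| in the leave-one-out bound, where E|V| ≤ 1.
  refine ⟨2 + K, by positivity, ?_⟩
  intro Ω _ μ _ ξ b n h L hm hind hb h0 hn hv hc hh0 hh1 hL0 hL
  obtain ⟨f, hf, hfK, hxf⟩ := hK h hc hh0 hh1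
  set c := ∫ z, h z ∂(gaussianReal 0 1) with hcdef
  have hn0 : (0 : ℝ) < n := by exact_mod_cast hn
  have hb0 : 0 ≤ b := by
    obtain ⟨ω⟩ : Nonempty Ω := nonempty_of_isProbabilityMeasure μ
    exact (abs_nonneg _).trans (hb 0 ω)
  have hhi : Integrable h (gaussianReal 0 1) :=
    integrable_of_abs_le (C := 1) hc.measurable
      fun x => by rw [abs_le]; constructor <;> linarith [hh0 x, hh1 x]
  have hc0 : 0 ≤ c := integral_nonneg hh0
  have hc1 : c ≤ 1 := by
    have := integral_mono hhi (integrable_const (1 : ℝ)) hh1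
    simpa using this
  have hD : ∀ x, |x * f x + (h x - c)| ≤ 2 := fun x => by
    have h1 := abs_le.1 (hxf x)
    rw [abs_le]; constructor <;> linarith [hh0 x, hh1 x]
  have hfc : Continuous f := continuous_iff_continuousAt.2 fun x => (hf x).continuousAt
  set W : Ω → ℝ := fun ω => ∑ k ∈ Finset.range n, ξ k ω with hW
  have hWm : Measurable W := by fun_prop
  have key : ∀ k ∈ Finset.range n,
      |∫ ω, ξ k ω * f (W ω) ∂μ - (1 / n) * ∫ ω, (W ω * f (W ω) + (h (W ω) - c)) ∂μ|
        ≤ (b ^ 3 + 1 / n * b) * (2 + (K + L)) := by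
    intro k hk
    set V : Ω → ℝ := fun ω => ∑ j ∈ (Finset.range n).erase k, ξ j ω with hV
    have hVm : Measurable V := by fun_prop
    have hVi : Integrable V μ :=
      integrable_finsetSum _ fun j _ => integrable_of_abs_le (hm j) (hb j)
    have hVW : ∀ ω, V ω + ξ k ω = W ω := fun ω => Finset.sum_erase_add _ _ hk
    have hXV : IndepFun (ξ k) V μ := by
      have := hind.indepFun_finsetSum_of_notMem hm (Finset.notMem_erase k (Finset.range n))
      refine IndepFun.symm ?_
      convert this using 1
      ext ω; simp [hV]
    have h1 := abs_integral_mul_stein_sub_le hf hfK hD hc hL hL0 (hm k) hVm hXV (hb k) hVi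
      (h0 k) (hv k)
    simp only [hVW] at h1
    refine h1.trans (mul_le_mul_of_nonneg_left ?_ (by positivity))
    have h2 : ∫ ω, |V ω| ∂μ ≤ 1 := by
      refine integral_abs_sum_le_one hm hind hb h0 hv _ ?_
      have : (((Finset.range n).erase k).card : ℝ) ≤ n := by
        exact_mod_cast (Finset.card_erase_le).trans_eq (Finset.card_range n)
      rw [mul_one_div]
      exact div_le_one_of_le₀ this hn0.le
    linarith
  have hfm := hfc.measurable
  have ihW : Integrable (fun ω => h (W ω)) μ := integrable_of_abs_le (C := 1)
      (hc.measurable.comp hWm) fun ω => by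
        rw [abs_le]; constructor <;> linarith [hh0 (W ω), hh1 (W ω)]
  have iWf : Integrable (fun ω => W ω * f (W ω)) μ :=
    integrable_of_abs_le (C := 1) (hWm.mul (hfm.comp hWm)) fun ω => hxf _
  have e1 : ∫ ω, W ω * f (W ω) ∂μ = ∑ k ∈ Finset.range n, ∫ ω, ξ k ω * f (W ω) ∂μ := by
    rw [← integral_finsetSum]
    · simp only [hW, Finset.sum_mul]
    · intro k _
      exact (integrable_of_abs_le (hm k) (hb k)).mul_bdd (c := K)
        (hfm.comp hWm).aestronglyMeasurable (.of_forall fun ω => hfK _)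
  have e2 : ∫ ω, (W ω * f (W ω) + (h (W ω) - c)) ∂μ
      = ∫ ω, W ω * f (W ω) ∂μ + (∫ ω, h (W ω) ∂μ - c) := by
    have i1 : Integrable (fun ω => h (W ω) - c) μ := ihW.sub (integrable_const _)
    rw [integral_add iWf i1, integral_sub ihW (integrable_const _)]
    simp
  -- By Stein's equation the left side is E[f'(W)] - E[W f(W)]; distributing E[f'(W)] as n equal
  -- shares 1/n matches it with the leave-one-out estimates.
  have e3 : ∫ ω, h (W ω) ∂μ - c = -∑ k ∈ Finset.range n, (∫ ω, ξ k ω * f (W ω) ∂μ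
      - (1 / n) * ∫ ω, (W ω * f (W ω) + (h (W ω) - c)) ∂μ) := by
    rw [Finset.sum_sub_distrib, ← e1, Finset.sum_const, Finset.card_range, nsmul_eq_mul,
      ← mul_assoc, mul_one_div_cancel hn0.ne', one_mul, e2]
    ring
  rw [e3, abs_neg]
  refine (Finset.abs_sum_le_sum_abs _ _).trans ((Finset.sum_le_sum key).trans_eq ?_)
  rw [Finset.sum_const, Finset.card_range, nsmul_eq_mul]
  field_simp
  ring

end BoundedSummands

/-! ### Distributions and sample proportions -/

theorem IsDistribution.le_one {A : Type*} {p : A → ℝ} (hp : IsDistribution p) (a : A) :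
    p a ≤ 1 :=
  le_hasSum hp.hasSum a fun b _ => hp.nonneg b

theorem IsDistribution.mem_Icc {A : Type*} {p : A → ℝ} (hp : IsDistribution p) (a : A) :
    p a ∈ Set.Icc (0 : ℝ) 1 :=
  ⟨hp.nonneg a, hp.le_one a⟩

theorem IsDistribution.summable_mul {A : Type*} {p : A → ℝ} (hp : IsDistribution p)
    {φ : A → ℝ} {C : ℝ} (hφ : ∀ a, |φ a| ≤ C) : Summable fun a => p a * φ a := by
  refine (hp.hasSum.summable.mul_right C).of_norm_bounded fun a => ?_
  rw [Real.norm_eq_abs, abs_mul, abs_of_nonneg (hp.nonneg a)]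
  exact mul_le_mul_of_nonneg_left (hφ a) (hp.nonneg a)

section SampleProportions

variable {A : Type*}

theorem sampleProp_nonneg (n : ℕ) (x : ℕ → A) (a : A) : 0 ≤ sampleProp n x a :=
  mul_nonneg (by positivity)
    (Finset.sum_nonneg fun _ _ => Set.indicator_nonneg (fun _ _ => zero_le_one) _)

theorem sampleProp_le_one (n : ℕ) (x : ℕ → A) (a : A) : sampleProp n x a ≤ 1 := by
  have h : ∑ k ∈ Finset.range n, ({a} : Set A).indicator (fun _ => (1 : ℝ)) (x k) ≤ n := by
    have := Finset.sum_le_card_nsmul (Finset.range n)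
      (fun k => ({a} : Set A).indicator (fun _ => (1 : ℝ)) (x k)) 1
      fun k _ => Set.indicator_le_self' (f := fun _ => (1 : ℝ)) (fun _ _ => zero_le_one) _
    simpa using this
  rw [sampleProp, one_div, inv_mul_eq_div]
  exact div_le_one_of_le₀ h (Nat.cast_nonneg n)

theorem finite_support_sampleProp (n : ℕ) (x : ℕ → A) :
    (Function.support (sampleProp n x)).Finite := by
  refine ((Finset.range n).finite_toSet.image x).subset fun a ha => ?_
  by_contra hne
  refine ha ?_
  rw [sampleProp, Finset.sum_eq_zero, mul_zero]
  intro k hk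
  rw [Set.indicator_of_notMem]
  rintro rfl
  exact hne ⟨k, hk, rfl⟩

/-- Turns a sum over letters into an average over observations; this makes the linear Taylor term a
sum of independent variables. -/
theorem hasSum_mul_sampleProp (n : ℕ) (x : ℕ → A) (φ : A → ℝ) :
    HasSum (fun a => φ a * sampleProp n x a) ((1 / n) * ∑ k ∈ Finset.range n, φ (x k)) := by
  have h : ∀ k, HasSum (fun a => φ a * ({a} : Set A).indicator (fun _ => (1 : ℝ)) (x k))
      (φ (x k)) := fun k => by
    classical
    convert hasSum_single (f := fun a => φ a * ({a} : Set A).indicator (fun _ => (1 : ℝ)) (x k))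
      (x k) (fun a ha => ?_) using 1
    · simp
    · simp [Set.indicator_of_notMem, Ne.symm ha]
  refine ((hasSum_sum fun k (_ : k ∈ Finset.range n) => h k).mul_left (1 / (n : ℝ))).congr_fun ?_
  intro a
  rw [sampleProp, ← Finset.mul_sum]
  ring

theorem sampleProp_congr {n : ℕ} {x y : ℕ → A} (h : ∀ k < n, x k = y k) :
    sampleProp n x = sampleProp n y := by
  ext a
  rw [sampleProp, sampleProp]
  congr 1
  exact Finset.sum_congr rfl fun k hk => by rw [h k (Finset.mem_range.1 hk)]

end SampleProportions

theorem IsIIDSample.integral_indicator {Ω A : Type*} [MeasurableSpace A]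
    [MeasurableSingletonClass A] [MeasurableSpace Ω] {μ : Measure Ω} {X : ℕ → Ω → A} {p : A → ℝ}
    (hX : IsIIDSample μ X p) (k : ℕ) (a : A) :
    ∫ ω, ({a} : Set A).indicator (fun _ => (1 : ℝ)) (X k ω) ∂μ = p a := by
  have e : ∀ ω, ({a} : Set A).indicator (fun _ => (1 : ℝ)) (X k ω)
      = {ω | X k ω = a}.indicator (fun _ => (1 : ℝ)) ω := fun ω => by
    by_cases h : X k ω = a <;> simp [h]
  have hm : MeasurableSet {ω | X k ω = a} := hX.measurable k (measurableSet_singleton a)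
  simp only [e]
  rw [integral_indicator_const _ hm, hX.law k a, smul_eq_mul, mul_one]

theorem abs_indicator_one_le {A : Type*} (s : Set A) (x : A) :
    |s.indicator (fun _ => (1 : ℝ)) x| ≤ 1 := by
  by_cases h : x ∈ s <;> simp [h]

/-! ### Moments of the sample -/

section Sample

variable {Ω A : Type*} [Countable A] [MeasurableSpace A] [MeasurableSingletonClass A]
  [MeasurableSpace Ω] {μ : Measure Ω} {X : ℕ → Ω → A} {p : A → ℝ}

theorem IsIIDSample.measurable_comp (hX : IsIIDSample μ X p) (φ : A → ℝ) (k : ℕ) :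
    Measurable fun ω => φ (X k ω) :=
  (measurable_of_countable φ).comp (hX.measurable k)

theorem IsIIDSample.iIndepFun_comp (hX : IsIIDSample μ X p) (φ : A → ℝ) :
    iIndepFun (fun k ω => φ (X k ω)) μ :=
  hX.indep.comp (fun _ => φ) fun _ => measurable_of_countable φ

variable [IsProbabilityMeasure μ]

theorem IsIIDSample.integral_comp (hX : IsIIDSample μ X p) {φ : A → ℝ} {C : ℝ}
    (hφ : ∀ a, |φ a| ≤ C) (k : ℕ) : ∫ ω, φ (X k ω) ∂μ = ∑' a, p a * φ a := by
  have hφm : Measurable φ := measurable_of_countable φ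
  have hprob := Measure.isProbabilityMeasure_map (μ := μ) (hX.measurable k).aemeasurable
  rw [← integral_map (hX.measurable k).aemeasurable hφm.aestronglyMeasurable,
    integral_countable (integrable_of_abs_le hφm hφ)]
  refine tsum_congr fun a => ?_
  rw [map_measureReal_apply (hX.measurable k) (measurableSet_singleton a), smul_eq_mul,
    ← hX.law k a]
  rfl

/-- The moments of the centred variables `φ (X k)`. -/
theorem IsIIDSample.centered_moments (hX : IsIIDSample μ X p) {φ : A → ℝ} {C : ℝ}
    (hφ : ∀ a, |φ a| ≤ C) (k : ℕ) :
    ∫ ω, (φ (X k ω) - ∑' a, p a * φ a) ∂μ = 0 ∧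
    ∫ ω, (φ (X k ω) - ∑' a, p a * φ a) ^ 2 ∂μ
      = (∑' a, p a * φ a ^ 2) - (∑' a, p a * φ a) ^ 2 := by
  have hi : Integrable (fun ω => φ (X k ω)) μ :=
    integrable_of_abs_le (hX.measurable_comp φ k) fun ω => hφ _
  have hφ2 : ∀ a, |φ a ^ 2| ≤ C ^ 2 := fun a => by
    rw [abs_pow]; exact pow_le_pow_left₀ (abs_nonneg _) (hφ a) 2
  have hi2 : Integrable (fun ω => φ (X k ω) ^ 2) μ :=
    integrable_of_abs_le ((hX.measurable_comp φ k).pow_const 2) fun ω => hφ2 _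
  have e1 := hX.integral_comp hφ k
  have e2 := hX.integral_comp hφ2 k
  set m := ∑' a, p a * φ a
  constructor
  · rw [integral_sub hi (integrable_const _), e1]; simp
  · have e : ∀ ω, (φ (X k ω) - m) ^ 2 = φ (X k ω) ^ 2 - 2 * m * φ (X k ω) + m ^ 2 :=
      fun ω => by ring
    have i1 : Integrable (fun ω => φ (X k ω) ^ 2 - 2 * m * φ (X k ω)) μ :=
      hi2.sub (hi.const_mul _)
    simp only [e]
    rw [integral_add i1 (integrable_const _), integral_sub hi2 (hi.const_mul _),
      integral_const_mul, e1, e2]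
    simp; ring

/-- Any function of the first `n` observations is measurable. -/
theorem IsIIDSample.measurable_of_range (hX : IsIIDSample μ X p) (n : ℕ) {F : (ℕ → A) → ℝ}
    (hF : ∀ x y : ℕ → A, (∀ k < n, x k = y k) → F x = F y) :
    Measurable fun ω => F fun k => X k ω := by
  obtain ⟨ω₀⟩ : Nonempty Ω := nonempty_of_isProbabilityMeasure μ
  -- Factoring through `Fin n → A`, which is countable, makes measurability automatic. The padding
  -- letter is arbitrary, since `F` ignores it.
  let ext : (Fin n → A) → ℕ → A := fun y k => if h : k < n then y ⟨k, h⟩ else X 0 ω₀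
  have h1 : Measurable fun y : Fin n → A => F (ext y) := measurable_of_countable _
  have h2 : Measurable fun ω => fun i : Fin n => X i ω :=
    measurable_pi_lambda _ fun i => hX.measurable i
  convert h1.comp h2 using 1
  ext ω
  refine hF _ _ fun k hk => ?_
  simp [ext, hk]

theorem IsIIDSample.measurable_sampleProp (hX : IsIIDSample μ X p) (n : ℕ) (a : A) :
    Measurable fun ω => sampleProp n (fun k => X k ω) a :=
  hX.measurable_of_range n (F := fun x => sampleProp n x a) fun x y h => by
    rw [sampleProp_congr h]

theorem IsIIDSample.measurable_plugIn (hX : IsIIDSample μ X p) (g : ℝ → ℝ) (n : ℕ) :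
    Measurable fun ω => plugIn g n fun k => X k ω :=
  hX.measurable_of_range n (F := plugIn g n) fun x y h => by
    rw [plugIn, plugIn, sampleProp_congr h]

theorem IsIIDSample.integrable_sampleProp (hX : IsIIDSample μ X p) (n : ℕ) (a : A) :
    Integrable (fun ω => sampleProp n (fun k => X k ω) a) μ :=
  integrable_of_abs_le (C := 1) (hX.measurable_sampleProp n a) fun ω => by
    rw [abs_of_nonneg (sampleProp_nonneg _ _ _)]; exact sampleProp_le_one _ _ _

theorem IsIIDSample.integral_sampleProp (hX : IsIIDSample μ X p) {n : ℕ} (hn : 1 ≤ n) (a : A) :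
    ∫ ω, sampleProp n (fun k => X k ω) a ∂μ = p a := by
  have hn0 : (n : ℝ) ≠ 0 := by positivity
  simp only [sampleProp]
  rw [integral_const_mul, integral_finsetSum]
  · simp only [hX.integral_indicator, Finset.sum_const, Finset.card_range, nsmul_eq_mul]
    field_simp
  · exact fun k _ => integrable_of_abs_le (hX.measurable_comp _ k)
      fun ω => abs_indicator_one_le _ _

/-- The exact value is p(1 - p)/n, the binomial variance. -/
theorem IsIIDSample.integral_sampleProp_sub_sq_le (hX : IsIIDSample μ X p) {n : ℕ} (hn : 1 ≤ n)
    (a : A) : ∫ ω, (sampleProp n (fun k => X k ω) a - p a) ^ 2 ∂μ ≤ p a / n := by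
  have hn0 : (n : ℝ) ≠ 0 := by positivity
  set φ : A → ℝ := ({a} : Set A).indicator fun _ => (1 : ℝ) with hφ
  have hφ1 : ∀ b, |φ b| ≤ 1 := abs_indicator_one_le _
  have hm : ∑' b, p b * φ b = p a := by
    rw [← hX.integral_comp hφ1 0]; exact hX.integral_indicator 0 a
  have hm2 : ∑' b, p b * φ b ^ 2 = p a := by
    rw [← hm]
    refine tsum_congr fun b => ?_
    by_cases h : b = a <;> simp [hφ, h]
  have hc := fun k => hX.centered_moments hφ1 k
  rw [hm, hm2] at hc
  have hind : iIndepFun (fun k ω => φ (X k ω) - p a) μ := hX.iIndepFun_comp fun b => φ b - p a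
  have h := integral_sum_sq (b := 1 + |p a|) (fun k => hX.measurable_comp (fun b => φ b - p a) k)
    hind
    (fun k ω => (abs_sub _ _).trans (add_le_add (hφ1 _) le_rfl)) (fun k => (hc k).1)
    (fun k => (hc k).2) (Finset.range n)
  have e : ∀ ω, (sampleProp n (fun k => X k ω) a - p a) ^ 2
      = (1 / (n : ℝ)) ^ 2 * (∑ k ∈ Finset.range n, (φ (X k ω) - p a)) ^ 2 := fun ω => by
    rw [← mul_pow, Finset.sum_sub_distrib, sampleProp, mul_sub]
    simp [hn0, hφ]
  simp only [e]
  rw [integral_const_mul, h, Finset.card_range]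
  have : (1 / (n : ℝ)) ^ 2 * (n * (p a - p a ^ 2)) = (p a - p a ^ 2) / n := by
    field_simp
  rw [this]
  gcongr
  nlinarith [sq_nonneg (p a)]

theorem IsIIDSample.integrable_sampleProp_sub_sq (hX : IsIIDSample μ X p) (n : ℕ) (a : A) :
    Integrable (fun ω => (sampleProp n (fun k => X k ω) a - p a) ^ 2) μ := by
  refine (memLp_two_of_abs_le (C := 1 + |p a|)
    ((hX.measurable_sampleProp n a).sub measurable_const) fun ω => ?_).integrable_sq
  refine (abs_sub _ _).trans (add_le_add ?_ le_rfl)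
  rw [abs_of_nonneg (sampleProp_nonneg _ _ _)]
  exact sampleProp_le_one _ _ _

theorem rpow_le_self_add_sq {y r : ℝ} (hy : 0 ≤ y) (h1 : 1 ≤ r) (h2 : r ≤ 2) :
    y ^ r ≤ y + y ^ 2 := by
  rcases le_total y 1 with h | h
  · have := Real.rpow_le_rpow_of_exponent_ge' hy h zero_le_one h1
    rw [Real.rpow_one] at this
    nlinarith [sq_nonneg y]
  · have := Real.rpow_le_rpow_of_exponent_le h h2
    rw [Real.rpow_two] at this
    linarith

theorem rpow_le_one_add_sq {y r : ℝ} (hy : 0 ≤ y) (h1 : 1 ≤ r) (h2 : r ≤ 2) :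
    y ^ r ≤ 1 + y ^ 2 := by
  rcases le_total y 1 with h | h
  · have := Real.rpow_le_one hy h (by linarith : 0 ≤ r)
    nlinarith [sq_nonneg y]
  · have := Real.rpow_le_rpow_of_exponent_le h h2
    rw [Real.rpow_two] at this
    linarith

theorem IsIIDSample.integrable_abs_sampleProp_sub_rpow (hX : IsIIDSample μ X p) (n : ℕ) (a : A)
    {r : ℝ} (h1 : 1 ≤ r) (h2 : r ≤ 2) :
    Integrable (fun ω => |sampleProp n (fun k => X k ω) a - p a| ^ r) μ := by
  have hm : Measurable fun ω => sampleProp n (fun k => X k ω) a - p a :=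
    (hX.measurable_sampleProp n a).sub measurable_const
  refine ((integrable_const (1 : ℝ)).add (hX.integrable_sampleProp_sub_sq n a)).mono'
    (hm.abs.pow_const r).aestronglyMeasurable (.of_forall fun ω => ?_)
  rw [Real.norm_eq_abs, abs_of_nonneg (by positivity)]
  simpa using rpow_le_one_add_sq (abs_nonneg (sampleProp n (fun k => X k ω) a - p a)) h1 h2

/-- Apply y^(1+β) ≤ y + y² with y = n |p̂ - p|, then E|p̂ - p| ≤ 2p and the variance bound. The
result is linear in p, hence summable over letters without further assumption. -/
theorem IsIIDSample.integral_abs_sampleProp_sub_rpow_le (hX : IsIIDSample μ X p)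
    (hp : IsDistribution p) {n : ℕ} (hn : 1 ≤ n) (a : A) {β : ℝ} (h0 : 0 ≤ β) (h1 : β ≤ 1) :
    ∫ ω, |sampleProp n (fun k => X k ω) a - p a| ^ (1 + β) ∂μ ≤ 3 * p a * (n : ℝ) ^ (-β) := by
  have hn0 : (0 : ℝ) < n := by exact_mod_cast hn
  have hpa := hp.nonneg a
  set S : Ω → ℝ := fun ω => sampleProp n (fun k => X k ω) a with hS
  have hS0 : ∀ ω, 0 ≤ S ω := fun ω => sampleProp_nonneg _ _ _
  have iS := hX.integrable_sampleProp n a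
  have iS2 := hX.integrable_sampleProp_sub_sq n a
  have hpt : ∀ ω, |S ω - p a| ^ (1 + β) ≤
      (n : ℝ) ^ (-(1 + β)) * (n * (S ω + p a) + n ^ 2 * (S ω - p a) ^ 2) := fun ω => by
    have h := rpow_le_self_add_sq (mul_nonneg hn0.le (abs_nonneg (S ω - p a)))
      (by linarith : 1 ≤ 1 + β) (by linarith)
    rw [Real.mul_rpow hn0.le (abs_nonneg _), mul_pow, sq_abs] at h
    have h3 : |S ω - p a| ≤ S ω + p a := by
      rw [abs_le]; constructor <;> linarith [hS0 ω]
    rw [Real.rpow_neg hn0.le, inv_mul_eq_div, le_div_iff₀ (by positivity), mul_comm]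
    have := mul_le_mul_of_nonneg_left h3 hn0.le
    linarith
  have i1 : Integrable (fun ω => (n : ℝ) * (S ω + p a)) μ :=
    (iS.add (integrable_const _)).const_mul _
  have i2 : Integrable (fun ω => (n : ℝ) ^ 2 * (S ω - p a) ^ 2) μ := iS2.const_mul _
  calc ∫ ω, |S ω - p a| ^ (1 + β) ∂μ
      ≤ ∫ ω, (n : ℝ) ^ (-(1 + β)) * (n * (S ω + p a) + n ^ 2 * (S ω - p a) ^ 2) ∂μ :=
        integral_mono (hX.integrable_abs_sampleProp_sub_rpow n a (by linarith) (by linarith))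
          ((i1.add i2).const_mul _) hpt
    _ = (n : ℝ) ^ (-(1 + β)) * (n * (p a + p a) + n ^ 2 * ∫ ω, (S ω - p a) ^ 2 ∂μ) := by
        rw [integral_const_mul, integral_add i1 i2, integral_const_mul, integral_const_mul,
          integral_add iS (integrable_const _), hX.integral_sampleProp hn]
        simp
    _ ≤ (n : ℝ) ^ (-(1 + β)) * (n * (p a + p a) + n ^ 2 * (p a / n)) := by
        gcongr
        exact hX.integral_sampleProp_sub_sq_le hn a
    _ = 3 * p a * (n : ℝ) ^ (-β) := by
        have : (n : ℝ) ^ (-β) = (n : ℝ) ^ (-(1 + β)) * n := by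
          rw [← Real.rpow_add_one hn0.ne']; congr 1; ring
        rw [this]
        field_simp
        ring

/-- Here the deviation is scaled by √(p/n), which bounds its standard deviation, and y^(1+β) ≤ 1 +
y² is used. The decay in n is at least as fast as n^(-β), but summing over letters now requires ∑
p^((β+1)/2) < ∞. -/
theorem IsIIDSample.integral_abs_sampleProp_sub_rpow_le' (hX : IsIIDSample μ X p)
    (hp : IsDistribution p) {n : ℕ} (hn : 1 ≤ n) (a : A) {β : ℝ} (h0 : 0 ≤ β) (h1 : β ≤ 1) :
    ∫ ω, |sampleProp n (fun k => X k ω) a - p a| ^ (1 + β) ∂μ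
      ≤ 2 * p a ^ ((β + 1) / 2) * (n : ℝ) ^ (-((β + 1) / 2)) := by
  have hn0 : (0 : ℝ) < n := by exact_mod_cast hn
  -- The scale vanishes when p a = 0; there the previous bound already gives zero.
  rcases (hp.nonneg a).eq_or_lt with hpa | hpa
  · have := hX.integral_abs_sampleProp_sub_rpow_le hp hn a h0 h1
    rw [← hpa] at this ⊢
    rw [Real.zero_rpow (by linarith)]
    simpa using this
  set S : Ω → ℝ := fun ω => sampleProp n (fun k => X k ω) a with hS
  have iS2 := hX.integrable_sampleProp_sub_sq n a
  have hq : 0 < p a / n := by positivity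
  set t := (p a / n) ^ ((1 : ℝ) / 2) with ht
  have ht0 : 0 < t := by positivity
  have ht2 : t ^ 2 = p a / n := by
    rw [ht, ← Real.rpow_two, ← Real.rpow_mul hq.le]; norm_num
  have hpt : ∀ ω, |S ω - p a| ^ (1 + β) ≤ t ^ (1 + β) * (1 + (p a / n)⁻¹ * (S ω - p a) ^ 2) :=
    fun ω => by
    have h := rpow_le_one_add_sq (div_nonneg (abs_nonneg (S ω - p a)) ht0.le)
      (by linarith : 1 ≤ 1 + β) (by linarith)
    rw [Real.div_rpow (abs_nonneg _) ht0.le, div_pow, sq_abs, ht2,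
      div_le_iff₀ (by positivity)] at h
    rw [inv_mul_eq_div, mul_comm]
    exact h
  have i2 : Integrable (fun ω => (p a / n)⁻¹ * (S ω - p a) ^ 2) μ := iS2.const_mul _
  calc ∫ ω, |S ω - p a| ^ (1 + β) ∂μ
      ≤ ∫ ω, t ^ (1 + β) * (1 + (p a / n)⁻¹ * (S ω - p a) ^ 2) ∂μ :=
        integral_mono (hX.integrable_abs_sampleProp_sub_rpow n a (by linarith) (by linarith))
          (((integrable_const _).add i2).const_mul _) hpt
    _ = t ^ (1 + β) * (1 + (p a / n)⁻¹ * ∫ ω, (S ω - p a) ^ 2 ∂μ) := by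
        rw [integral_const_mul, integral_add (integrable_const _) i2, integral_const_mul]
        simp
    _ ≤ t ^ (1 + β) * (1 + (p a / n)⁻¹ * (p a / n)) := by
        gcongr
        exact hX.integral_sampleProp_sub_sq_le hn a
    _ = 2 * p a ^ ((β + 1) / 2) * (n : ℝ) ^ (-((β + 1) / 2)) := by
        rw [inv_mul_cancel₀ hq.ne', ht, ← Real.rpow_mul hq.le, Real.rpow_neg hn0.le,
          Real.div_rpow hpa.le hn0.le]
        rw [show (1 : ℝ) / 2 * (1 + β) = (β + 1) / 2 by ring]
        ring

end Sample

/-- Under either summability regime the `(1 + β)`-th absolute moments of the sample proportions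
are summable over the alphabet, with the rate `n ^ (-(1 / 2 + γ))`. -/
theorem exists_summable_moment_bound {A : Type*} [Countable A] [MeasurableSpace A]
    [MeasurableSingletonClass A] {p : A → ℝ} (hp : IsDistribution p) {β : ℝ} (h0 : 0 ≤ β)
    (h1 : β ≤ 1) (hcond : 1 / 2 < β ∨ (β ≤ 1 / 2 ∧ Summable fun a => p a ^ ((β + 1) / 2))) :
    ∃ B : A → ℝ, Summable B ∧ (∀ a, 0 ≤ B a) ∧
      ∀ {Ω : Type*} [MeasurableSpace Ω] (μ : Measure Ω) [IsProbabilityMeasure μ]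
        (X : ℕ → Ω → A), IsIIDSample μ X p → ∀ n : ℕ, 1 ≤ n → ∀ a,
        ∫ ω, |sampleProp n (fun k => X k ω) a - p a| ^ (1 + β) ∂μ
          ≤ B a * (n : ℝ) ^ (-(1 / 2 + rateExponent β)) := by
  rcases hcond with hβ | ⟨hβ, hs⟩
  · refine ⟨fun a => 3 * p a, hp.hasSum.summable.mul_left 3,
      fun a => by have := hp.nonneg a; positivity, ?_⟩
    intro Ω _ μ _ X hX n hn a
    have e : -(1 / 2 + rateExponent β) = -β := by
      rw [rateExponent, if_neg (not_le.2 hβ)]; ring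
    rw [e]
    exact hX.integral_abs_sampleProp_sub_rpow_le hp hn a h0 h1
  · refine ⟨fun a => 2 * p a ^ ((β + 1) / 2), hs.mul_left 2,
      fun a => by have := hp.nonneg a; positivity, ?_⟩
    intro Ω _ μ _ X hX n hn a
    have e : -(1 / 2 + rateExponent β) = -((β + 1) / 2) := by
      rw [rateExponent, if_pos hβ]; ring
    rw [e]
    exact hX.integral_abs_sampleProp_sub_rpow_le' hp hn a h0 h1

/-! ### Linearisation of the plug-in estimator -/

/-- Mean value inequality for t ↦ g t - t g'(x) between x and y, where the Hölder condition bounds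
the derivative by M |y - x|^β. -/
theorem abs_sub_sub_deriv01_mul_le {g : ℝ → ℝ} {M β : ℝ≥0}
    (hg : DifferentiableOn ℝ g (Set.Icc 0 1))
    (hM : HolderOnWith M β (deriv01 g) (Set.Icc 0 1)) {x y : ℝ}
    (hx : x ∈ Set.Icc (0 : ℝ) 1) (hy : y ∈ Set.Icc (0 : ℝ) 1) :
    |g y - g x - deriv01 g x * (y - x)| ≤ M * |y - x| ^ (1 + (β : ℝ)) := by
  have hsub : Set.uIcc x y ⊆ Set.Icc 0 1 := Set.uIcc_subset_Icc hx hy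
  have h := (convex_uIcc x y).norm_image_sub_le_of_norm_hasDerivWithin_le
    (f := fun t => g t - t * deriv01 g x)
    (f' := fun t => deriv01 g t - deriv01 g x)
    (C := M * |y - x| ^ (β : ℝ)) (x := x) (y := y)
    (fun t ht => ?_) (fun t ht => ?_) Set.left_mem_uIcc Set.right_mem_uIcc
  · rw [Real.rpow_add' (abs_nonneg _) (by positivity), Real.rpow_one, mul_comm |y - x|,
      ← mul_assoc]
    refine le_of_eq_of_le ?_ h
    rw [Real.norm_eq_abs]
    congr 1
    ring
  · refine (((hg t (hsub ht)).hasDerivWithinAt.mono hsub).sub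
      ((hasDerivWithinAt_id t _).mul_const _)).congr_deriv ?_
    simp [deriv01]
  · rw [← dist_eq_norm]
    refine (hM.dist_le (hsub ht) hx).trans ?_
    rw [Real.dist_eq]
    refine mul_le_mul_of_nonneg_left (Real.rpow_le_rpow (abs_nonneg _) ?_ β.2) M.2
    exact Set.abs_sub_left_of_mem_uIcc ht

/-- The index vanishes on letters of probability zero. -/
theorem eq_zero_at_zero {A : Type*} [Infinite A] {g : ℝ → ℝ} {p : A → ℝ}
    (hg : DifferentiableOn ℝ g (Set.Icc 0 1)) (hp : IsDistribution p)
    (hgp : Summable fun a => |g (p a)|) : g 0 = 0 := by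
  have h1 : Filter.Tendsto p Filter.cofinite (nhdsWithin 0 (Set.Icc 0 1)) :=
    tendsto_nhdsWithin_iff.2 ⟨hp.hasSum.summable.tendsto_cofinite_zero, .of_forall hp.mem_Icc⟩
  have h2 := (hg.continuousOn 0 (by simp)).tendsto.comp h1
  exact tendsto_nhds_unique h2 hgp.of_abs.tendsto_cofinite_zero

theorem exists_bound_deriv01 {g : ℝ → ℝ} {M β : ℝ≥0}
    (hM : HolderOnWith M β (deriv01 g) (Set.Icc 0 1)) :
    ∃ G : ℝ, 0 ≤ G ∧ ∀ x ∈ Set.Icc (0 : ℝ) 1, |deriv01 g x| ≤ G := by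
  refine ⟨|deriv01 g 0| + M, by positivity, fun x hx => ?_⟩
  have h := hM.dist_le hx (show (0 : ℝ) ∈ Set.Icc 0 1 by simp)
  rw [Real.dist_eq, Real.dist_eq, sub_zero, abs_of_nonneg hx.1] at h
  have h2 : (M : ℝ) * x ^ (β : ℝ) ≤ M * 1 := by
    gcongr
    exact Real.rpow_le_one hx.1 hx.2 β.2
  have h3 := abs_sub_abs_le_abs_sub (deriv01 g x) (deriv01 g 0)
  linarith

section Linearization

variable {A : Type*} [Infinite A] {g : ℝ → ℝ} {p : A → ℝ} {M β : ℝ≥0}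

/-- The error of the linearisation of the plug-in estimator. -/
theorem abs_plugIn_sub_index_sub_le (hg : DifferentiableOn ℝ g (Set.Icc 0 1))
    (hM : HolderOnWith M β (deriv01 g) (Set.Icc 0 1)) (hp : IsDistribution p)
    (hgp : Summable fun a => |g (p a)|) {n : ℕ} (hn : 1 ≤ n) (x : ℕ → A) :
    (Summable fun a => (M : ℝ) * |sampleProp n x a - p a| ^ (1 + (β : ℝ))) ∧
    |plugIn g n x - index g p - (1 / n) * ∑ k ∈ Finset.range n,
        (deriv01 g (p (x k)) - ∑' a, p a * deriv01 g (p a))|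
      ≤ ∑' a, M * |sampleProp n x a - p a| ^ (1 + (β : ℝ)) := by
  have hn0 : (n : ℝ) ≠ 0 := by positivity
  have hg0 := eq_zero_at_zero hg hp hgp
  obtain ⟨G, hG0, hG⟩ := exists_bound_deriv01 hM
  have hS : ∀ a, sampleProp n x a ∈ Set.Icc (0 : ℝ) 1 := fun a =>
    ⟨sampleProp_nonneg _ _ _, sampleProp_le_one _ _ _⟩
  have hSs : Summable (sampleProp n x) :=
    summable_of_hasFiniteSupport (finite_support_sampleProp n x)
  have hsum : Summable fun a => (M : ℝ) * |sampleProp n x a - p a| ^ (1 + (β : ℝ)) := by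
    refine Summable.mul_left _ ((hSs.add hp.hasSum.summable).of_nonneg_of_le
      (fun a => by positivity) fun a => ?_)
    have h0 := hp.mem_Icc a
    have h1 : |sampleProp n x a - p a| ≤ 1 := by
      rw [abs_le]; constructor <;> linarith [(hS a).1, (hS a).2, h0.1, h0.2]
    have h2 := Real.rpow_le_rpow_of_exponent_ge' (abs_nonneg _) h1 zero_le_one
      (show (1 : ℝ) ≤ 1 + β by simp)
    rw [Real.rpow_one] at h2
    refine h2.trans ?_
    rw [abs_le]; constructor <;> linarith [(hS a).1, h0.1]
  refine ⟨hsum, ?_⟩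
  -- Letters not yet observed contribute g 0 = 0, so the sum is finite.
  have s1 : HasSum (fun a => g (sampleProp n x a)) (plugIn g n x) := by
    refine (summable_of_hasFiniteSupport ((finite_support_sampleProp n x).subset ?_)).hasSum
    intro a ha h
    exact ha (by simp only [h, hg0])
  have s2 : HasSum (fun a => g (p a)) (index g p) := hgp.of_abs.hasSum
  have s3 := hasSum_mul_sampleProp n x fun a => deriv01 g (p a)
  have s4 := (hp.summable_mul (φ := fun a => deriv01 g (p a))
    fun a => hG _ (hp.mem_Icc a)).hasSum
  have s5 := (s1.sub s2).sub (s3.sub s4)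
  have e : plugIn g n x - index g p - (1 / n) * ∑ k ∈ Finset.range n,
        (deriv01 g (p (x k)) - ∑' a, p a * deriv01 g (p a))
      = plugIn g n x - index g p - ((1 / n) * ∑ k ∈ Finset.range n,
        deriv01 g (p (x k)) - ∑' a, p a * deriv01 g (p a)) := by
    rw [Finset.sum_sub_distrib]
    simp [mul_sub, hn0]
  rw [e, ← s5.tsum_eq, ← Real.norm_eq_abs]
  refine tsum_of_norm_bounded hsum.hasSum fun a => ?_
  refine le_of_eq_of_le ?_ (abs_sub_sub_deriv01_mul_le hg hM (hp.mem_Icc a) (hS a))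
  rw [Real.norm_eq_abs]
  congr 1
  ring

end Linearization

/-- The pointwise bound on the remainder is integrated letter by letter. Working with `lintegral`
lets Tonelli exchange sum and integral, and gives the integrability of `R` at the same time. -/
theorem exists_integral_abs_remainder_le {A : Type*} [Countable A] [Infinite A]
    [MeasurableSpace A] [MeasurableSingletonClass A] {g : ℝ → ℝ} {p : A → ℝ} {M β : ℝ≥0}
    (hβ1 : β ≤ 1) (hg : DifferentiableOn ℝ g (Set.Icc 0 1))
    (hM : HolderOnWith M β (deriv01 g) (Set.Icc 0 1)) (hp : IsDistribution p)
    (hgp : Summable fun a => |g (p a)|)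
    (hcond : (1 / 2 < (β : ℝ)) ∨
      ((β : ℝ) ≤ 1 / 2 ∧ Summable fun a => p a ^ (((β : ℝ) + 1) / 2))) :
    ∃ C : ℝ, 0 ≤ C ∧ ∀ {Ω : Type*} [MeasurableSpace Ω] (μ : Measure Ω) [IsProbabilityMeasure μ]
      (X : ℕ → Ω → A), IsIIDSample μ X p → ∀ n : ℕ, 1 ≤ n → ∀ R : Ω → ℝ,
      (∀ ω, R ω = plugIn g n (fun k => X k ω) - index g p - (1 / n) * ∑ k ∈ Finset.range n,
        (deriv01 g (p (X k ω)) - ∑' a, p a * deriv01 g (p a))) →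
      Integrable R μ ∧
        ∫ ω, |R ω| ∂μ ≤ C * (n : ℝ) ^ (-(1 / 2 + rateExponent (β : ℝ))) := by
  obtain ⟨B, hBs, hB0, hB⟩ := exists_summable_moment_bound hp β.2 hβ1 hcond
  refine ⟨M * ∑' a, B a, mul_nonneg M.2 (tsum_nonneg hB0), ?_⟩
  intro Ω _ μ _ X hX n hn R hR
  set ρ := (n : ℝ) ^ (-(1 / 2 + rateExponent (β : ℝ))) with hρ
  have hρ0 : 0 ≤ ρ := by positivity
  have hRm : Measurable R := by
    rw [funext hR]
    exact ((hX.measurable_plugIn g n).sub measurable_const).sub ((Finset.measurable_fun_sum _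
      fun k _ => (hX.measurable_comp (fun a => deriv01 g (p a)) k).sub measurable_const).const_mul
        _)
  set D : A → Ω → ℝ := fun a ω => M * |sampleProp n (fun k => X k ω) a - p a| ^ (1 + (β : ℝ))
    with hD
  have hD0 : ∀ a ω, 0 ≤ D a ω := fun a ω => by positivity
  have hDi : ∀ a, Integrable (D a) μ := fun a =>
    (hX.integrable_abs_sampleProp_sub_rpow n a (by simp)
      (by have : (β : ℝ) ≤ 1 := hβ1
          linarith)).const_mul _
  have hsB : Summable fun a => M * (B a * ρ) := (hBs.mul_right ρ).mul_left _
  have hl : ∫⁻ ω, ENNReal.ofReal |R ω| ∂μ ≤ ENNReal.ofReal (M * (∑' a, B a) * ρ) := by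
    calc ∫⁻ ω, ENNReal.ofReal |R ω| ∂μ ≤ ∫⁻ ω, ∑' a, ENNReal.ofReal (D a ω) ∂μ := by
          refine lintegral_mono fun ω => ?_
          obtain ⟨h1, h2⟩ := abs_plugIn_sub_index_sub_le hg hM hp hgp hn fun k => X k ω
          rw [← hR ω] at h2
          rw [← ENNReal.ofReal_tsum_of_nonneg (fun a => hD0 a ω) h1]
          exact ENNReal.ofReal_le_ofReal h2
      _ = ∑' a, ∫⁻ ω, ENNReal.ofReal (D a ω) ∂μ :=
          lintegral_tsum fun a => (hDi a).aestronglyMeasurable.aemeasurable.ennreal_ofReal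
      _ ≤ ∑' a, ENNReal.ofReal (M * (B a * ρ)) := by
          refine ENNReal.tsum_le_tsum fun a => ?_
          rw [← ofReal_integral_eq_lintegral_ofReal (hDi a) (.of_forall (hD0 a))]
          refine ENNReal.ofReal_le_ofReal ?_
          rw [hD]
          simp only []
          rw [integral_const_mul]
          exact mul_le_mul_of_nonneg_left (hB μ X hX n hn a) M.2
      _ = ENNReal.ofReal (M * (∑' a, B a) * ρ) := by
          rw [← ENNReal.ofReal_tsum_of_nonneg
            (fun a => mul_nonneg M.coe_nonneg (mul_nonneg (hB0 a) hρ0)) hsB, tsum_mul_left,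
            tsum_mul_right, mul_assoc]
  have hRi : Integrable R μ := by
    refine ⟨hRm.aestronglyMeasurable, ?_⟩
    rw [hasFiniteIntegral_iff_norm]
    exact hl.trans_lt ENNReal.ofReal_lt_top
  refine ⟨hRi, ?_⟩
  rw [← ofReal_integral_eq_lintegral_ofReal hRi.abs (.of_forall fun ω => abs_nonneg _)] at hl
  exact (ENNReal.ofReal_le_ofReal_iff
    (mul_nonneg (mul_nonneg M.2 (tsum_nonneg hB0)) hρ0)).1 hl

/-! ### Smoothing of indicators -/

/-- The Gaussian density is at most 1/√(2π) ≤ 1. -/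
theorem cdf_gaussianReal_sub_le {x y : ℝ} (hxy : x ≤ y) :
    cdf (gaussianReal 0 1) y - cdf (gaussianReal 0 1) x ≤ y - x := by
  have hpdf : ∀ t, gaussianPDF 0 1 t ≤ 1 := fun t => by
    rw [gaussianPDF, ← ENNReal.ofReal_one]
    refine ENNReal.ofReal_le_ofReal ?_
    rw [gaussianPDFReal]
    refine mul_le_one₀ (inv_le_one_of_one_le₀ ?_) (Real.exp_pos _).le (Real.exp_le_one_iff.2 ?_)
    · rw [Real.one_le_sqrt]
      have := Real.pi_gt_three
      simp; linarith
    · exact div_nonpos_of_nonpos_of_nonneg (neg_nonpos.2 (sq_nonneg _)) (by positivity)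
  have h1 : gaussianReal 0 1 (Set.Ioc x y) ≤ ENNReal.ofReal (y - x) := by
    rw [gaussianReal_apply _ one_ne_zero, ← Real.volume_Ioc, ← setLIntegral_one]
    exact lintegral_mono fun t => hpdf t
  rw [cdf_eq_real, cdf_eq_real, ← measureReal_sdiff (Set.Iic_subset_Iic.2 hxy) measurableSet_Iic,
    Set.Iic_sdiff_Iic]
  exact ENNReal.toReal_le_of_le_ofReal (by linarith) h1

/-- The piecewise linear function which is `1` up to `x` and `0` from `x + δ` on. -/
noncomputable def ramp (δ x w : ℝ) : ℝ := max 0 (min 1 ((x + δ - w) / δ))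

section Ramp

variable {δ : ℝ} (x : ℝ)

theorem ramp_nonneg (w : ℝ) : 0 ≤ ramp δ x w := le_max_left _ _

theorem ramp_le_one (w : ℝ) : ramp δ x w ≤ 1 := max_le zero_le_one (min_le_left _ _)

theorem continuous_ramp : Continuous (ramp δ x) := by
  unfold ramp
  fun_prop

theorem abs_ramp_sub_le (hδ : 0 < δ) (w z : ℝ) : |ramp δ x w - ramp δ x z| ≤ δ⁻¹ * |w - z| := by
  refine (abs_max_sub_max_le_max _ _ _ _).trans (max_le (by simp; positivity) ?_)
  refine (abs_min_sub_min_le_max _ _ _ _).trans (max_le (by simp; positivity) ?_)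
  rw [← sub_div, abs_div, abs_of_pos hδ, div_eq_inv_mul, abs_sub_comm w z]
  refine le_of_eq ?_
  congr 2
  ring

theorem measureReal_Iic_le_integral_ramp (hδ : 0 < δ) (ν : Measure ℝ) [IsProbabilityMeasure ν] :
    ν.real (Set.Iic x) ≤ ∫ w, ramp δ x w ∂ν := by
  have hi : Integrable (ramp δ x) ν := integrable_of_abs_le (C := 1) (continuous_ramp x).measurable
    fun w => by rw [abs_of_nonneg (ramp_nonneg x w)]; exact ramp_le_one x w
  rw [← integral_indicator_one measurableSet_Iic]
  refine integral_mono ((integrable_const 1).indicator measurableSet_Iic) hi fun w => ?_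
  refine Set.indicator_le' (fun w hw => ?_) (fun w _ => ramp_nonneg x w) w
  refine le_max_of_le_right (le_min le_rfl ?_)
  rw [Pi.one_apply, le_div_iff₀ hδ]
  have : w ≤ x := hw
  linarith

theorem integral_ramp_le_measureReal_Iic (hδ : 0 < δ) (ν : Measure ℝ) [IsProbabilityMeasure ν] :
    ∫ w, ramp δ x w ∂ν ≤ ν.real (Set.Iic (x + δ)) := by
  have hi : Integrable (ramp δ x) ν := integrable_of_abs_le (C := 1) (continuous_ramp x).measurable
    fun w => by rw [abs_of_nonneg (ramp_nonneg x w)]; exact ramp_le_one x w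
  rw [← integral_indicator_one measurableSet_Iic]
  refine integral_mono hi ((integrable_const 1).indicator measurableSet_Iic) fun w => ?_
  refine Set.le_indicator (fun w _ => ramp_le_one x w) (fun w hw => ?_) w
  refine max_le le_rfl (min_le_of_right_le (div_nonpos_of_nonpos_of_nonneg ?_ hδ.le))
  have : x + δ < w := not_le.1 hw
  linarith

end Ramp

/-- Comparison of distribution functions from comparison of Lipschitz test functions. -/
theorem abs_measureReal_sub_cdf_le {Ω : Type*} [MeasurableSpace Ω] {μ : Measure Ω}
    [IsProbabilityMeasure μ] {W : Ω → ℝ} (hW : Measurable W) {δ ε : ℝ} (hδ : 0 < δ)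
    (hh : ∀ h : ℝ → ℝ, Continuous h → (∀ x, 0 ≤ h x) → (∀ x, h x ≤ 1) →
      (∀ x y, |h x - h y| ≤ δ⁻¹ * |x - y|) →
      |∫ ω, h (W ω) ∂μ - ∫ z, h z ∂(gaussianReal 0 1)| ≤ ε) (x : ℝ) :
    |μ.real {ω | W ω ≤ x} - cdf (gaussianReal 0 1) x| ≤ ε + δ := by
  have hprob := Measure.isProbabilityMeasure_map (μ := μ) hW.aemeasurable
  have hF : μ.real {ω | W ω ≤ x} = (μ.map W).real (Set.Iic x) := by
    rw [map_measureReal_apply hW measurableSet_Iic]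
    rfl
  have key : ∀ y, |∫ w, ramp δ y w ∂(μ.map W) - ∫ z, ramp δ y z ∂(gaussianReal 0 1)| ≤ ε :=
    fun y => by
    rw [integral_map hW.aemeasurable (continuous_ramp y).aestronglyMeasurable]
    exact hh _ (continuous_ramp y) (ramp_nonneg y) (ramp_le_one y) (abs_ramp_sub_le y hδ)
  have k1 := abs_le.1 (key x)
  -- The ramp descending on [x - δ, x] gives the lower bound, the one on [x, x + δ] the upper bound.
  have k2 := abs_le.1 (key (x - δ))
  have a1 := measureReal_Iic_le_integral_ramp x hδ (μ.map W)
  have a2 := integral_ramp_le_measureReal_Iic x hδ (gaussianReal 0 1)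
  have a3 := measureReal_Iic_le_integral_ramp (x - δ) hδ (gaussianReal 0 1)
  have a4 := integral_ramp_le_measureReal_Iic (x - δ) hδ (μ.map W)
  have c1 := cdf_gaussianReal_sub_le (show x ≤ x + δ by linarith)
  have c2 := cdf_gaussianReal_sub_le (show x - δ ≤ x by linarith)
  rw [← cdf_eq_real] at a2 a3
  rw [sub_add_cancel] at a4
  rw [hF, abs_le]
  constructor <;> linarith [k1.1, k1.2, k2.1, k2.2]

theorem rateExponent_mem {β : ℝ} (h0 : 0 ≤ β) (h1 : β ≤ 1) :
    0 ≤ rateExponent β ∧ rateExponent β ≤ 1 / 2 := by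
  unfold rateExponent
  split_ifs with h
  · constructor <;> linarith
  · constructor <;> linarith

end DiversityIndex

/-! ### The normal approximation rate -/

theorem corollary2p2
    {A : Type*} [Countable A] [Infinite A] [MeasurableSpace A] [MeasurableSingletonClass A]
    (g : ℝ → ℝ) (β : ℝ≥0) (p : A → ℝ)
    (hβ0 : 0 < β) (hβ1 : β ≤ 1)
    (hg : DifferentiableOn ℝ g (Set.Icc 0 1))
    (hg' : ∃ M : ℝ≥0, HolderOnWith M β (DiversityIndex.deriv01 g) (Set.Icc 0 1))
    (hp : DiversityIndex.IsDistribution p)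
    (hgp : Summable fun a => |g (p a)|)
    (hσ : 0 < DiversityIndex.asympVar g p)
    (hcond : (1 / 2 < (β : ℝ)) ∨
      ((β : ℝ) ≤ 1 / 2 ∧ Summable fun a => p a ^ (((β : ℝ) + 1) / 2))) :
    ∃ C : ℝ, ∀ (Ω : Type*) [MeasurableSpace Ω] (μ : Measure Ω) [IsProbabilityMeasure μ]
      (X : ℕ → Ω → A), DiversityIndex.IsIIDSample μ X p →
      ∀ n : ℕ, 1 ≤ n → ∀ x : ℝ,
        |μ.real {ω | √(n : ℝ) / √(DiversityIndex.asympVar g p) *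
              (DiversityIndex.plugIn g n (fun k => X k ω) - DiversityIndex.index g p) ≤ x}
            - cdf (gaussianReal 0 1) x|
          ≤ C / (n : ℝ) ^ (DiversityIndex.rateExponent (β : ℝ) / 2) := by
  open DiversityIndex in
  obtain ⟨M, hM⟩ := hg'
  obtain ⟨G, hG0, hG⟩ := exists_bound_deriv01 hM
  obtain ⟨K, hK0, hK⟩ := exists_normal_approx_lipschitz
  obtain ⟨Q, hQ0, hQ⟩ := exists_integral_abs_remainder_le hβ1 hg hM hp hgp hcond
  obtain ⟨hγ0, hγ1⟩ := rateExponent_mem β.coe_nonneg hβ1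
  set γ := rateExponent (β : ℝ) with hγ
  set v := asympVar g p with hv
  set σ := √v with hσdef
  have hσ0 : 0 < σ := Real.sqrt_pos.2 hσ
  have hσ2 : σ ^ 2 = v := Real.sq_sqrt hσ.le
  set φ : A → ℝ := fun a => deriv01 g (p a) with hφ
  have hφG : ∀ a, |φ a| ≤ G := fun a => hG _ (hp.mem_Icc a)
  set m := ∑' a, p a * φ a with hm
  set b₀ := (G + |m|) / σ with hb₀
  have hb₀0 : 0 ≤ b₀ := by positivity
  -- The three terms account for the normal approximation of the linear part, the linearisation
  -- remainder and the smoothing.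
  refine ⟨(b₀ ^ 2 + 1) * b₀ * (K + 1) + Q / σ + 1, ?_⟩
  intro Ω _ μ _ X hX n hn x
  have hn1 : (1 : ℝ) ≤ n := by exact_mod_cast hn
  have hn0 : (0 : ℝ) < n := by linarith
  have hs0 : 0 < √(n : ℝ) := Real.sqrt_pos.2 hn0
  have hs2 : √(n : ℝ) ^ 2 = n := Real.sq_sqrt hn0.le
  set δ := (n : ℝ) ^ (-(γ / 2)) with hδ
  have hδ0 : 0 < δ := by positivity
  have hδ1 : δ ≤ 1 := Real.rpow_le_one_of_one_le_of_nonpos hn1 (by linarith)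
  have hδ2 : δ ^ 2 = (n : ℝ) ^ (-γ) := by
    rw [hδ, ← Real.rpow_natCast, ← Real.rpow_mul hn0.le]
    congr 1
    push_cast; ring
  have hsδ : (√(n : ℝ))⁻¹ ≤ δ ^ 2 := by
    rw [hδ2, Real.sqrt_eq_rpow, ← Real.rpow_neg hn0.le]
    exact Real.rpow_le_rpow_of_exponent_le hn1 (by linarith)
  set R : Ω → ℝ := fun ω => plugIn g n (fun k => X k ω) - index g p
    - (1 / n) * ∑ k ∈ Finset.range n, (φ (X k ω) - m) with hR
  obtain ⟨hRi, hRQ⟩ := hQ μ X hX n hn R fun ω => rfl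
  set ξ : ℕ → Ω → ℝ := fun k ω => (φ (X k ω) - m) / (σ * √n) with hξ
  set W : Ω → ℝ := fun ω => √n / σ * (plugIn g n (fun k => X k ω) - index g p) with hW
  have hWm : Measurable W := ((hX.measurable_plugIn g n).sub measurable_const).const_mul _
  have hdecomp : ∀ ω, W ω - ∑ k ∈ Finset.range n, ξ k ω = √n / σ * R ω := fun ω => by
    simp only [hW, hξ, hR]
    rw [← Finset.sum_div]
    nth_rewrite 4 [← hs2]
    field_simp
  have hξm : ∀ k, Measurable (ξ k) := hX.measurable_comp fun a => (φ a - m) / (σ * √n)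
  have hξi : iIndepFun ξ μ := hX.iIndepFun_comp fun a => (φ a - m) / (σ * √n)
  have hξb : ∀ k ω, |ξ k ω| ≤ b₀ / √n := fun k ω => by
    rw [hb₀, div_div, hξ]
    simp only []
    rw [abs_div, abs_of_pos (by positivity : 0 < σ * √(n : ℝ))]
    gcongr
    exact (abs_sub _ _).trans (add_le_add (hφG _) le_rfl)
  have hξ0 : ∀ k, ∫ ω, ξ k ω ∂μ = 0 := fun k => by
    simp only [hξ]
    rw [integral_div, (hX.centered_moments hφG k).1, zero_div]
  have hξv : ∀ k, ∫ ω, ξ k ω ^ 2 ∂μ = 1 / n := fun k => by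
    simp only [hξ, div_pow]
    rw [integral_div, (hX.centered_moments hφG k).2, mul_pow, hs2, hσ2]
    have : (∑' a, p a * φ a ^ 2) - m ^ 2 = v := rfl
    rw [this]
    field_simp
  have main := abs_measureReal_sub_cdf_le (μ := μ) hWm hδ0
    (ε := ((b₀ ^ 2 + 1) * b₀ * (K + 1) + Q / σ) * δ) ?_ x
  · refine main.trans_eq ?_
    rw [hδ, Real.rpow_neg hn0.le, div_eq_mul_inv]
    ring
  intro h hc h0 h1 hL
  have e1 := hK μ ξ (b₀ / √n) n h δ⁻¹ hξm hξi hξb hξ0 hn hξv hc h0 h1 (by positivity) hL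
  have ih : ∀ Y : Ω → ℝ, Measurable Y → Integrable (fun ω => h (Y ω)) μ := fun Y hY =>
    integrable_of_abs_le (C := 1) (hc.measurable.comp hY) fun ω => by
      rw [abs_of_nonneg (h0 _)]; exact h1 _
  have hTm : Measurable fun ω => ∑ k ∈ Finset.range n, ξ k ω := by fun_prop
  have e2 : |∫ ω, h (W ω) ∂μ - ∫ ω, h (∑ k ∈ Finset.range n, ξ k ω) ∂μ| ≤ Q / σ * δ := by
    rw [← integral_sub (ih _ hWm) (ih _ hTm)]
    calc |∫ ω, (h (W ω) - h (∑ k ∈ Finset.range n, ξ k ω)) ∂μ|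
        ≤ ∫ ω, δ⁻¹ * (√n / σ) * |R ω| ∂μ := by
          rw [← Real.norm_eq_abs]
          refine norm_integral_le_of_norm_le (hRi.abs.const_mul _) (.of_forall fun ω => ?_)
          refine (hL _ _).trans_eq ?_
          rw [hdecomp, abs_mul, abs_of_pos (by positivity : 0 < √(n : ℝ) / σ), mul_assoc]
      _ = δ⁻¹ * (√n / σ) * ∫ ω, |R ω| ∂μ := integral_const_mul _ _
      _ ≤ δ⁻¹ * (√n / σ) * (Q * (n : ℝ) ^ (-(1 / 2 + γ))) := by gcongr
      _ = Q / σ * δ := by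
          have : (n : ℝ) ^ (-(1 / 2 + γ)) = (√(n : ℝ))⁻¹ * δ ^ 2 := by
            rw [hδ2, Real.sqrt_eq_rpow, ← Real.rpow_neg hn0.le, ← Real.rpow_add hn0]
            congr 1; ring
          rw [this]
          field_simp
  -- With b = b₀/√n, b² n does not depend on n, so the single factor b supplies 1/√n ≤ δ²; the
  -- Lipschitz constant δ⁻¹ leaves δ.
  have e3 : ((b₀ / √n) ^ 2 * n + 1) * (b₀ / √n) * (K + δ⁻¹) ≤ (b₀ ^ 2 + 1) * b₀ * (K + 1) * δ := by
    have : (b₀ / √n) ^ 2 * n = b₀ ^ 2 := by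
      rw [div_pow, hs2]; field_simp
    rw [this]
    have hKδ : K + δ⁻¹ ≤ (K + 1) * δ⁻¹ := by
      have : 1 ≤ δ⁻¹ := (one_le_inv₀ hδ0).2 hδ1
      nlinarith
    calc (b₀ ^ 2 + 1) * (b₀ / √n) * (K + δ⁻¹)
        = (b₀ ^ 2 + 1) * b₀ * ((√(n : ℝ))⁻¹ * (K + δ⁻¹)) := by rw [div_eq_mul_inv]; ring
      _ ≤ (b₀ ^ 2 + 1) * b₀ * (δ ^ 2 * ((K + 1) * δ⁻¹)) := by gcongr
      _ = (b₀ ^ 2 + 1) * b₀ * (K + 1) * δ := by field_simp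
  have e4 := abs_sub_le (∫ ω, h (W ω) ∂μ) (∫ ω, h (∑ k ∈ Finset.range n, ξ k ω) ∂μ)
    (∫ z, h z ∂(gaussianReal 0 1))
  linarith
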